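/- Let $Q=[-1,1]^2$, and let $\varphi_k(t)=\sqrt{k+1/2}\,(2^kk!)^{-1}\frac{d^k}{dt^k}(t^2-1)^k$, $k=0,1,2,\dots$, be the Legendre polynomials orthonormal on $[-1,1]$. For $f\in L_2(Q)$ put $\langle f,\varphi_{k,j}\rangle=\int_{-1}^1\int_{-1}^1 f(t,\tau)\varphi_k(t)\varphi_j(\tau)\,d\tau\,dt$ and, for $1\le s<\infty$ and $\mu>0$, $$\|f\|_{s,\mu}=\Big(\sum_{k,j=0}^\infty \max\{1,kj\}^{s\mu}\,|\langle f,\varphi_{k,j}\rangle|^s\Big)^{1/s}.$$ For an integer $r\ge 1$ let $f^{(r,r)}=\sum_{k,j\ge r}\langle f,\varphi_{k,j}\rangle\,\varphi_k^{(r)}(t)\varphi_j^{(r)}(\tau)$, the series being understood in $L_2(Q)$. For a real double sequence $y=(y_{k,j})_{k,j\ge 0}$ and $n\in\mathbb N$ let $$\mathcal D_n^{(r,r)}y=\sum_{(k,j)\in\Gamma_n}y_{k,j}\,\varphi_k^{(r)}(t)\varphi_j^{(r)}(\tau),\qquad \Gamma_n=\{(k,j):\ r\le k,j\le n-1,\ kj\le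 rn-1\}.$$ **Theorem.** Let $r\ge1$ be an integer, $1\le s<\infty$, $1\le p\le\infty$ (with $1/p=0$ for $p=\infty$) and $\mu>2r-\frac1s+\frac12$. Then for every $f\in L_2(Q)$ with $\|f\|_{s,\mu}\le1$ the series defining $f^{(r,r)}$ converges unconditionally in $L_2(Q)$. Moreover, for all $\delta_0\in(0,1)$ and $c_1,c_2>0$ there is a constant $c>0$, depending only on $r,s,p,\mu,\delta_0,c_1,c_2$, such that for every $f\in L_2(Q)$ with $\|f\|_{s,\mu}\le1$, every $\delta\in(0,\delta_0]$, every real double sequence $f^\delta=(f^\delta_{k,j})$ (the perturbed coefficients) with $\|(\langle f,\varphi_{k,j}\rangle-f^\delta_{k,j})_{k,j}\|_{\ell_p}\le\delta$, and every $n\in\mathbb N$ with $$c_1\Big(\delta^{-1}\ln^{\frac1p-\frac1s}\tfrac1\delta\Big)^{\frac1{\mu-1/p+1/s}}\le n\le c_2\Big(\delta^{-1}\ln^{\frac1p-\frac1s}\tfrac1\delta\Big)^{\frac1{\mu-1/p+1/s}},$$ one has $$\big\|f^{(r,r)}-\mathcal D_n^{(r,r)}f^\delta\big\|_{L_2(Q)}\le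 c\,\Big(\delta\ln^{\frac1s-\frac1p}\tfrac1\delta\Big)^{\frac{\mu-2r+1/s-1/2}{\mu-1/p+1/s}}\ln^{\frac32-\frac1s}\tfrac1\delta .$$ -/

import Mathlib

open MeasureTheory
open scoped ENNReal

noncomputable section

namespace LegendreDiff

/-- The square `Q = [-1,1]²`. -/
def Q : Set (ℝ × ℝ) := Set.Icc (-1) 1 ×ˢ Set.Icc (-1) 1

/-- The real Hilbert space `L₂(Q)`, with Lebesgue measure on `Q`. -/
abbrev L2Q : Type := Lp ℝ 2 ((volume : Measure (ℝ × ℝ)).restrict Q)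

/-- The Legendre polynomial of degree `k`, orthonormal on `[-1,1]` (Rodrigues formula). -/
def phi (k : ℕ) : Polynomial ℝ :=
  Polynomial.C (√((k : ℝ) + 1 / 2) * ((2 : ℝ) ^ k * (k.factorial : ℝ))⁻¹) *
    (Polynomial.derivative^[k]) ((Polynomial.X ^ 2 - 1) ^ k)

theorem memLp_tensor (u v : Polynomial ℝ) :
    MemLp (fun z : ℝ × ℝ => u.eval z.1 * v.eval z.2) 2
      ((volume : Measure (ℝ × ℝ)).restrict Q) := by
  have hQ : IsCompact Q := isCompact_Icc.prod isCompact_Icc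
  have hc : Continuous (fun z : ℝ × ℝ => u.eval z.1 * v.eval z.2) :=
    (u.continuous.comp continuous_fst).mul (v.continuous.comp continuous_snd)
  have : IsFiniteMeasure ((volume : Measure (ℝ × ℝ)).restrict Q) :=
    ⟨by simpa using hQ.measure_lt_top⟩
  obtain ⟨C, hC⟩ := hQ.exists_bound_of_continuousOn hc.continuousOn
  refine MemLp.of_bound hc.aestronglyMeasurable C ?_
  exact (ae_restrict_iff' hQ.measurableSet).2 (Filter.Eventually.of_forall hC)

/-- The element `(t, τ) ↦ u(t) v(τ)` of `L₂(Q)`, for polynomials `u`, `v`. -/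
def tensor (u v : Polynomial ℝ) : L2Q := (memLp_tensor u v).toLp _

/-- The Fourier–Legendre coefficient `⟨f, φ_{k,j}⟩`, `φ_{k,j}(t,τ) = φ_k(t) φ_j(τ)`,
for `q = (k, j)`. -/
def coeff (f : L2Q) (q : ℕ × ℕ) : ℝ := inner ℝ f (tensor (phi q.1) (phi q.2))

/-- The terms `max{1, k j}^{sμ} |⟨f, φ_{k,j}⟩|^s` whose sum is `‖f‖_{s,μ}^s`. -/
def normTerm (s μ : ℝ) (f : L2Q) (q : ℕ × ℕ) : ℝ :=
  (max 1 ((q.1 : ℝ) * (q.2 : ℝ))) ^ (s * μ) * |coeff f q| ^ s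

/-- The unit ball of `L^μ_{s,2}(Q)`: `‖f‖_{s,μ} < ∞` and `‖f‖_{s,μ} ≤ 1`. -/
def unitBall (s μ : ℝ) : Set L2Q :=
  {f | Summable (normTerm s μ f) ∧ (∑' q, normTerm s μ f q) ^ (1 / s) ≤ 1}

/-- The element `(t, τ) ↦ φ_k^{(r)}(t) φ_j^{(r)}(τ)` of `L₂(Q)`, for `q = (k, j)`. -/
def dphi (r : ℕ) (q : ℕ × ℕ) : L2Q :=
  tensor ((Polynomial.derivative^[r]) (phi q.1)) ((Polynomial.derivative^[r]) (phi q.2))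

/-- The terms of the series `∑_{k,j ≥ r} ⟨f, φ_{k,j}⟩ φ_k^{(r)} φ_j^{(r)}`. -/
def derivTerm (r : ℕ) (f : L2Q) (q : {q : ℕ × ℕ // r ≤ q.1 ∧ r ≤ q.2}) : L2Q :=
  coeff f q.1 • dphi r q.1

/-- The mixed derivative `f^{(r,r)}`, the sum of that series in `L₂(Q)`
(meaningful when the series converges). -/
def mixedDeriv (r : ℕ) (f : L2Q) : L2Q := ∑' q, derivTerm r f q

/-- The hyperbolic cross `Γ_n = {(k,j) : k j ≤ r n - 1, k, j = r, …, n - 1}`. -/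
def cross (r n : ℕ) : Finset (ℕ × ℕ) :=
  (Finset.Ico r n ×ˢ Finset.Ico r n).filter (fun q => q.1 * q.2 + 1 ≤ r * n)

/-- The truncation method `D_n^{(r,r)}` applied to the data `y` (the perturbed coefficients). -/
def truncation (r n : ℕ) (y : ℕ × ℕ → ℝ) : L2Q := ∑ q ∈ cross r n, y q • dphi r q

/-- The data `y` are coefficients of `f` perturbed by at most `δ` in `ℓ_p`:
`ξ = (⟨f, φ_{k,j}⟩ - y_{k,j})` lies in `ℓ_p` and `‖ξ‖_{ℓ_p} ≤ δ`. -/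
def IsPerturbation (p : ℝ≥0∞) (δ : ℝ) (f : L2Q) (y : ℕ × ℕ → ℝ) : Prop :=
  ∃ ξ : lp (fun _ : ℕ × ℕ => ℝ) p, (∀ q, ξ q = coeff f q - y q) ∧ ‖ξ‖ ≤ δ

end LegendreDiff

end

noncomputable section

namespace LegendreDiff


/-! The error splits into a truncation error (exact coefficients outside the cross) and a propagated
data error (noise inside it). Both are bounded by summing norms of terms; no orthogonality is used.
Put `N = r n`, `L = ln(1/δ)`, `S = 1/s`, `P = 1/p`.

The analytic input is `‖φ_k^{(r)}‖ ≲ k^{2r-1/2}`, hence `‖dphi r (k,j)‖ ≲ (kj)^{2r-1/2}`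
(`exists_norm_dphi_le`). It comes from repeated integration by parts in the Rodrigues formula.

Outside the cross `kj ≥ N`. Weighted Hölder against the unit ball, with the tail of `∑ (kj)^{-γ}`
over this region, gives absolute convergence and the bound `N^{-ρ} (1 + ln N)^{1-S}`, where `ρ = μ -
2r + S - 1/2` (`exists_sum_coeff_tail_le`). Inside the cross there are at most `N (1 + ln N)`
points, so Hölder on the noise gives `N^{2r-1/2} (N (1 + ln N))^{1-P} δ`
(`exists_norm_truncation_sub_le`).

The prescribed size of `n` balances the two: each becomes a multiple of `Y^{-ρ} L^{1-S}` with `Y =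
(δ⁻¹ L^{P-S})^{1/κ}`, `κ = μ - P + S`. This is stronger than the claim by a factor `L^{1/2}`, which
is bounded below because `δ ≤ δ₀ < 1`. -/

/-! ### Sums and cardinalities over hyperbolic regions. -/

/-- A discrete integral test. The difference on the right controls `(j+1)^{-γ}` by `log x ≤ x - 1`
and `1 + x ≤ exp x`; the factor `2^γ` pays for passing from `j + 1` back to `j`, as `j + 1 ≤ 2j`. -/
theorem rpow_neg_le_telescope {γ : ℝ} (hγ : 1 < γ) {j : ℕ} (hj : 1 ≤ j) :
    (j : ℝ) ^ (-γ) ≤ 2 ^ γ / (γ - 1) * ((j : ℝ) ^ (1 - γ) - ((j + 1 : ℕ) : ℝ) ^ (1 - γ)) := by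
  have hj' : (1 : ℝ) ≤ j := by exact_mod_cast hj
  have hj0 : (0 : ℝ) < j := by linarith
  have hx : (0 : ℝ) < (j : ℝ) + 1 := by linarith
  push_cast
  have hlog : Real.log ((j : ℝ) / (j + 1)) ≤ -(1 / ((j : ℝ) + 1)) := by
    have := Real.log_le_sub_one_of_pos (div_pos hj0 hx)
    have h2 : (j : ℝ) / (j + 1) - 1 = -(1 / ((j : ℝ) + 1)) := by field_simp; ring
    linarith
  have hB : 1 + (γ - 1) / ((j : ℝ) + 1) ≤ ((j : ℝ) / (j + 1)) ^ (1 - γ) := by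
    rw [Real.rpow_def_of_pos (div_pos hj0 hx)]
    have := Real.add_one_le_exp (Real.log ((j : ℝ) / (j + 1)) * (1 - γ))
    have h3 : (γ - 1) / ((j : ℝ) + 1) ≤ Real.log ((j : ℝ) / (j + 1)) * (1 - γ) := by
      have h4 := mul_le_mul_of_nonneg_right hlog (sub_nonneg.2 hγ.le)
      have h5 : (γ - 1) / ((j : ℝ) + 1) = 1 / ((j : ℝ) + 1) * (γ - 1) := by ring
      rw [h5]; nlinarith
    linarith
  have hdiff : (γ - 1) * ((j : ℝ) + 1) ^ (-γ) ≤ (j : ℝ) ^ (1 - γ) - ((j : ℝ) + 1) ^ (1 - γ) := by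
    rw [Real.div_rpow hj0.le hx.le, le_div_iff₀ (Real.rpow_pos_of_pos hx _)] at hB
    have h6 : ((j : ℝ) + 1) ^ (-γ) = ((j : ℝ) + 1) ^ (1 - γ) / ((j : ℝ) + 1) := by
      rw [show -γ = (1 - γ) - 1 by ring, Real.rpow_sub_one hx.ne']
    rw [h6]
    have h7 : (1 + (γ - 1) / ((j : ℝ) + 1)) * ((j : ℝ) + 1) ^ (1 - γ) =
        ((j : ℝ) + 1) ^ (1 - γ) + (γ - 1) * (((j : ℝ) + 1) ^ (1 - γ) / ((j : ℝ) + 1)) := by ring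
    linarith
  have h2j : (j : ℝ) ^ (-γ) ≤ 2 ^ γ * ((j : ℝ) + 1) ^ (-γ) := by
    have h8 : (2 * (j : ℝ)) ^ (-γ) ≤ ((j : ℝ) + 1) ^ (-γ) :=
      Real.rpow_le_rpow_of_nonpos hx (by linarith) (by linarith)
    rw [Real.mul_rpow (by norm_num) hj0.le] at h8
    have h9 : (2 : ℝ) ^ γ * (2 ^ (-γ) * (j : ℝ) ^ (-γ)) = (j : ℝ) ^ (-γ) := by
      rw [← mul_assoc, ← Real.rpow_add (by norm_num)]; simp
    rw [← h9]
    gcongr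
  calc (j : ℝ) ^ (-γ) ≤ 2 ^ γ * ((j : ℝ) + 1) ^ (-γ) := h2j
    _ = 2 ^ γ / (γ - 1) * ((γ - 1) * ((j : ℝ) + 1) ^ (-γ)) := by
        have : γ - 1 ≠ 0 := by linarith
        field_simp
    _ ≤ _ := by
        have : 0 < γ - 1 := by linarith
        gcongr

theorem sum_rpow_neg_tail_le {γ : ℝ} (hγ : 1 < γ) {x : ℝ} (hx : 0 < x) (T : Finset ℕ)
    (hT : ∀ j ∈ T, x ≤ j) :
    ∑ j ∈ T, (j : ℝ) ^ (-γ) ≤ 2 ^ γ / (γ - 1) * x ^ (1 - γ) := by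
  have hγ' : 0 < γ - 1 := by linarith
  set m := ⌈x⌉₊ with hm
  have hm1 : 1 ≤ m := Nat.one_le_ceil_iff.2 hx
  have hsub : T ⊆ Finset.Ico m (m + (T.sup id + 1)) := by
    intro j hj
    have h1 : m ≤ j := Nat.ceil_le.2 (hT j hj)
    have h2 : j ≤ T.sup id := Finset.le_sup (f := id) hj
    rw [Finset.mem_Ico]; omega
  have hind : ∀ K : ℕ, ∑ j ∈ Finset.Ico m (m + K), (j : ℝ) ^ (-γ) ≤
      2 ^ γ / (γ - 1) * ((m : ℝ) ^ (1 - γ) - ((m + K : ℕ) : ℝ) ^ (1 - γ)) := by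
    intro K
    induction K with
    | zero => simp
    | succ K ih =>
      rw [← add_assoc, Finset.sum_Ico_succ_top (by omega)]
      have := rpow_neg_le_telescope hγ (j := m + K) (by omega)
      rw [mul_sub] at this ih ⊢
      linarith
  calc ∑ j ∈ T, (j : ℝ) ^ (-γ)
      ≤ ∑ j ∈ Finset.Ico m (m + (T.sup id + 1)), (j : ℝ) ^ (-γ) :=
        Finset.sum_le_sum_of_subset_of_nonneg hsub fun _ _ _ => by positivity
    _ ≤ _ := hind _
    _ ≤ 2 ^ γ / (γ - 1) * (m : ℝ) ^ (1 - γ) := by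
        gcongr
        have : 0 ≤ ((m + (T.sup id + 1) : ℕ) : ℝ) ^ (1 - γ) := by positivity
        linarith
    _ ≤ _ := by
        have := Real.rpow_le_rpow_of_nonpos hx (Nat.le_ceil x) (z := 1 - γ) (by linarith)
        gcongr

theorem sum_Icc_inv_le_one_add_log (N : ℕ) :
    ∑ k ∈ Finset.Icc 1 N, (k : ℝ)⁻¹ ≤ 1 + Real.log N := by
  have h := harmonic_le_one_add_log N
  rw [harmonic_eq_sum_Icc] at h
  push_cast at h
  exact h

/-- Sum over `j` first. For `k ≤ N` the inner tail starts at the real number `N/k` and contributes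
`N^{1-γ}/k`, so the harmonic sum produces the logarithm. For `k > N` the inner sum is bounded by a
multiple of `k^{-γ}`, and the tail in `k` gives `N^{1-γ}` again. -/
theorem exists_sum_hyperbolic_tail_le {γ : ℝ} (hγ : 1 < γ) :
    ∃ C : ℝ, 0 < C ∧ ∀ (N : ℕ), 1 ≤ N → ∀ T : Finset (ℕ × ℕ),
      (∀ q ∈ T, 1 ≤ q.1 ∧ 1 ≤ q.2 ∧ N ≤ q.1 * q.2) →
      ∑ q ∈ T, ((q.1 : ℝ) * q.2) ^ (-γ) ≤ C * ((N : ℝ) ^ (1 - γ) * (1 + Real.log N)) := by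
  have hγ' : 0 < γ - 1 := by linarith
  set D : ℝ := 2 ^ γ / (γ - 1) with hD
  have hD0 : 0 < D := by positivity
  refine ⟨D + D * D, by positivity, fun N hN T hT => ?_⟩
  have hN0 : (0 : ℝ) < N := by exact_mod_cast hN
  have hlog : 0 ≤ Real.log N := Real.log_natCast_nonneg N
  set A := T.image Prod.fst
  set B := T.image Prod.snd
  set F : ℕ → Finset ℕ := fun k => B.filter fun j => 1 ≤ j ∧ N ≤ k * j
  have hstep : ∑ q ∈ T, ((q.1 : ℝ) * q.2) ^ (-γ) ≤
      ∑ k ∈ A.filter (fun k => 1 ≤ k), ∑ j ∈ F k, ((k : ℝ) * j) ^ (-γ) := by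
    rw [Finset.sum_sigma']
    refine (Finset.sum_bij_ne_zero (fun q _ _ => (⟨q.1, q.2⟩ : (_ : ℕ) × ℕ)) (s := T)
      (t := T.image fun q => (⟨q.1, q.2⟩ : (_ : ℕ) × ℕ)) (g := fun x => ((x.1 : ℝ) * x.2) ^ (-γ))
      ?_ ?_ ?_ ?_).le.trans (Finset.sum_le_sum_of_subset_of_nonneg ?_ ?_)
    · intro q hq _; exact Finset.mem_image_of_mem _ hq
    · rintro ⟨a, b⟩ _ _ ⟨c, d⟩ _ _ h
      simpa using h
    · intro x hx hx0
      obtain ⟨q, hq, rfl⟩ := Finset.mem_image.1 hx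
      exact ⟨q, hq, hx0, rfl⟩
    · intros; rfl
    · intro x hx
      obtain ⟨q, hq, rfl⟩ := Finset.mem_image.1 hx
      have := hT q hq
      simp only [Finset.mem_sigma, Finset.mem_filter, F, A, B]
      exact ⟨⟨Finset.mem_image_of_mem _ hq, this.1⟩, Finset.mem_image_of_mem _ hq, this.2.1,
        this.2.2⟩
    · intros; positivity
  have hmul : ∀ k : ℕ, ∑ j ∈ F k, ((k : ℝ) * j) ^ (-γ) =
      (k : ℝ) ^ (-γ) * ∑ j ∈ F k, (j : ℝ) ^ (-γ) := by
    intro k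
    rw [Finset.mul_sum]
    exact Finset.sum_congr rfl fun j _ => Real.mul_rpow (by positivity) (by positivity)
  have hsmall : ∀ k : ℕ, 1 ≤ k → ∑ j ∈ F k, ((k : ℝ) * j) ^ (-γ) ≤
      D * (N : ℝ) ^ (1 - γ) * (k : ℝ)⁻¹ := by
    intro k hk
    have hk0 : (0 : ℝ) < k := by exact_mod_cast hk
    have h1 := sum_rpow_neg_tail_le hγ (x := (N : ℝ) / k) (by positivity) (F k) (by
      intro j hj
      rw [div_le_iff₀ hk0]
      have := (Finset.mem_filter.1 hj).2.2
      rw [mul_comm]; exact_mod_cast this)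
    rw [hmul]
    calc (k : ℝ) ^ (-γ) * ∑ j ∈ F k, (j : ℝ) ^ (-γ)
        ≤ (k : ℝ) ^ (-γ) * (D * ((N : ℝ) / k) ^ (1 - γ)) := by gcongr
      _ = D * (N : ℝ) ^ (1 - γ) * (k : ℝ)⁻¹ := by
        rw [Real.div_rpow hN0.le hk0.le, show -γ = (1 - γ) - 1 by ring,
          Real.rpow_sub_one hk0.ne']
        have : (k : ℝ) ^ (1 - γ) ≠ 0 := (Real.rpow_pos_of_pos hk0 _).ne'
        field_simp
  have hlarge : ∀ k : ℕ, ∑ j ∈ F k, ((k : ℝ) * j) ^ (-γ) ≤ D * (k : ℝ) ^ (-γ) := by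
    intro k
    have h1 := sum_rpow_neg_tail_le hγ (x := 1) one_pos (F k) (by
      intro j hj
      exact_mod_cast (Finset.mem_filter.1 hj).2.1)
    rw [hmul]
    rw [Real.one_rpow, mul_one] at h1
    rw [mul_comm D]
    gcongr
  rw [← Finset.sum_filter_add_sum_filter_not (A.filter fun k => 1 ≤ k) (fun k => k ≤ N)] at hstep
  have hp1 : ∑ k ∈ (A.filter fun k => 1 ≤ k).filter (fun k => k ≤ N),
      ∑ j ∈ F k, ((k : ℝ) * j) ^ (-γ) ≤ D * (N : ℝ) ^ (1 - γ) * (1 + Real.log N) := by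
    calc _ ≤ ∑ k ∈ (A.filter fun k => 1 ≤ k).filter (fun k => k ≤ N),
          D * (N : ℝ) ^ (1 - γ) * (k : ℝ)⁻¹ := Finset.sum_le_sum fun k hk =>
            hsmall k (Finset.mem_filter.1 (Finset.mem_filter.1 hk).1).2
      _ ≤ ∑ k ∈ Finset.Icc 1 N, D * (N : ℝ) ^ (1 - γ) * (k : ℝ)⁻¹ := by
          refine Finset.sum_le_sum_of_subset_of_nonneg ?_ fun _ _ _ => by positivity
          intro k hk
          simp only [Finset.mem_filter] at hk
          exact Finset.mem_Icc.2 ⟨hk.1.2, hk.2⟩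
      _ ≤ _ := by
          rw [← Finset.mul_sum]
          gcongr
          exact sum_Icc_inv_le_one_add_log N
  have hp2 : ∑ k ∈ (A.filter fun k => 1 ≤ k).filter (fun k => ¬ k ≤ N),
      ∑ j ∈ F k, ((k : ℝ) * j) ^ (-γ) ≤ D * (D * (N : ℝ) ^ (1 - γ)) := by
    calc _ ≤ ∑ k ∈ (A.filter fun k => 1 ≤ k).filter (fun k => ¬ k ≤ N),
          D * (k : ℝ) ^ (-γ) := Finset.sum_le_sum fun k _ => hlarge k
      _ ≤ _ := by
          rw [← Finset.mul_sum]
          gcongr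
          refine sum_rpow_neg_tail_le hγ hN0 _ fun k hk => ?_
          have := (Finset.mem_filter.1 hk).2
          exact_mod_cast (not_le.1 this).le
  have hfin : D * (D * (N : ℝ) ^ (1 - γ)) ≤ D * (D * (N : ℝ) ^ (1 - γ)) * (1 + Real.log N) :=
    le_mul_of_one_le_right (by positivity) (by linarith)
  calc _ ≤ _ := hstep
    _ ≤ D * (N : ℝ) ^ (1 - γ) * (1 + Real.log N) +
        D * (D * (N : ℝ) ^ (1 - γ)) * (1 + Real.log N) := by linarith
    _ = _ := by ring

theorem card_hyperbolic_le (N : ℕ) (T : Finset (ℕ × ℕ))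
    (hT : ∀ q ∈ T, 1 ≤ q.1 ∧ 1 ≤ q.2 ∧ q.1 * q.2 ≤ N) :
    (T.card : ℝ) ≤ N * (1 + Real.log N) := by
  have hsub : T ⊆ (Finset.Icc 1 N).biUnion
      fun k => (Finset.Icc 1 (N / k)).image fun j => (k, j) := by
    rintro ⟨k, j⟩ hq
    obtain ⟨h1, h2, h3⟩ := hT _ hq
    simp only at h1 h2 h3
    simp only [Finset.mem_biUnion, Finset.mem_image, Finset.mem_Icc, Prod.mk.injEq]
    exact ⟨k, ⟨h1, by nlinarith⟩, j, ⟨h2, (Nat.le_div_iff_mul_le h1).2 (by linarith)⟩, rfl, rfl⟩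
  have hc : T.card ≤ ∑ k ∈ Finset.Icc 1 N, N / k := by
    refine (Finset.card_le_card hsub).trans (Finset.card_biUnion_le.trans ?_)
    refine Finset.sum_le_sum fun k _ => Finset.card_image_le.trans ?_
    simp
  calc (T.card : ℝ) ≤ ((∑ k ∈ Finset.Icc 1 N, N / k : ℕ) : ℝ) := by exact_mod_cast hc
    _ = ∑ k ∈ Finset.Icc 1 N, ((N / k : ℕ) : ℝ) := by push_cast; rfl
    _ ≤ ∑ k ∈ Finset.Icc 1 N, (N : ℝ) * (k : ℝ)⁻¹ := Finset.sum_le_sum fun k _ => by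
        rw [← div_eq_mul_inv]; exact Nat.cast_div_le
    _ ≤ _ := by
        rw [← Finset.mul_sum]
        gcongr
        exact sum_Icc_inv_le_one_add_log N


/-! ### Norms of derivatives of Legendre polynomials. -/

-- Derivatives at `a` are factorials times Taylor coefficients at `a`, and the factor `(X - a)^k`
-- merely shifts those coefficients by `k`.
open Polynomial in
theorem eval_iterate_derivative_pow_mul (a : ℝ) (k m : ℕ) (R : ℝ[X]) :
    (derivative^[k + m] ((X - C a) ^ k * R)).eval a * (m.factorial : ℝ) =
      ((k + m).factorial : ℝ) * (derivative^[m] R).eval a := by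
  have hD : ∀ (i : ℕ) (p : ℝ[X]),
      (derivative^[i] p).eval a = (i.factorial : ℝ) * (taylor a p).coeff i := by
    intro i p
    rw [taylor_coeff, ← factorial_smul_hasseDeriv]
    simp [nsmul_eq_mul]
  rw [hD, hD]
  have : taylor a ((X - C a) ^ k * R) = X ^ k * taylor a R := by
    simp [taylor_mul, taylor_pow, taylor_X]
  rw [this, add_comm k m, coeff_X_pow_mul]
  ring

open Polynomial in
theorem eval_iterate_derivative_eq_zero_of_lt (a : ℝ) {k i : ℕ} (hi : i < k) (R : ℝ[X]) :
    (derivative^[i] ((X - C a) ^ k * R)).eval a = 0 := by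
  rw [← factorial_smul_hasseDeriv]
  simp only [LinearMap.smul_apply, eval_smul, ← taylor_coeff]
  have : taylor a ((X - C a) ^ k * R) = X ^ k * taylor a R := by
    simp [taylor_mul, taylor_pow, taylor_X]
  rw [this, coeff_X_pow_mul', if_neg (by omega), smul_zero]

open Polynomial in
theorem X_sq_sub_one_pow_eq (k : ℕ) {a : ℝ} (ha : a ^ 2 = 1) :
    ((X : ℝ[X]) ^ 2 - 1) ^ k = (X - C a) ^ k * (X + C a) ^ k := by
  rw [← mul_pow]
  congr 1
  have : (C a : ℝ[X]) ^ 2 = 1 := by rw [← C_pow, ha, C_1]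
  linear_combination this

-- At `a = ±1` the value is explicit: `(k+m)!/m!` times the `m`-th derivative of `(X + a)^k`, that
-- is `k(k-1)⋯(k-m+1) (2a)^{k-m}`. Each of the two factorial quotients contributes `k^m`. For `m >
-- k` the falling factorial vanishes, so the truncated `k - m` is harmless.
open Polynomial in
theorem abs_eval_iterate_derivative_rodrigues_le (k m : ℕ) (hk : 1 ≤ k) {a : ℝ}
    (ha : a ^ 2 = 1) :
    |(derivative^[k + m] (((X : ℝ[X]) ^ 2 - 1) ^ k)).eval a| ≤
      (2 : ℝ) ^ k * k.factorial * ((m + 1 : ℝ) ^ m * (k : ℝ) ^ (2 * m)) := by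
  have habs : |a| = 1 := by
    rw [← sq_abs] at ha
    nlinarith [abs_nonneg a]
  have h := eval_iterate_derivative_pow_mul a k m ((X + C a) ^ k)
  rw [← X_sq_sub_one_pow_eq k ha, iterate_derivative_X_add_pow] at h
  simp only [eval_mul, eval_pow, eval_add, eval_X, eval_C, eval_natCast,
    nsmul_eq_mul] at h
  have hm : (0 : ℝ) < m.factorial := by exact_mod_cast m.factorial_pos
  have hfac : ((k + m).factorial : ℝ) ≤ k.factorial * ((m + 1 : ℝ) * k) ^ m := by
    have h1 : (k + m).factorial ≤ k.factorial * (k + m) ^ m :=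
      (Nat.factorial_mul_ascFactorial k m).symm.le.trans
        (Nat.mul_le_mul_left _ (Nat.ascFactorial_le_pow_add k m))
    have h2 : k + m ≤ (m + 1) * k := by nlinarith
    exact_mod_cast h1.trans (Nat.mul_le_mul_left _ (Nat.pow_le_pow_left h2 m))
  have hdesc : ((k.descFactorial m : ℕ) : ℝ) ≤ (k : ℝ) ^ m := by
    exact_mod_cast Nat.descFactorial_le_pow k m
  have h2 : |(a + a) ^ (k - m)| ≤ (2 : ℝ) ^ k := by
    rw [abs_pow, ← two_mul, abs_mul, habs]
    norm_num
    exact pow_le_pow_right₀ (by norm_num) (Nat.sub_le _ _)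
  have hle : |(derivative^[k + m] (((X : ℝ[X]) ^ 2 - 1) ^ k)).eval a| ≤
      |(derivative^[k + m] (((X : ℝ[X]) ^ 2 - 1) ^ k)).eval a * (m.factorial : ℝ)| := by
    rw [abs_mul, abs_of_pos hm]
    exact le_mul_of_one_le_right (abs_nonneg _) (by exact_mod_cast m.factorial_pos)
  refine hle.trans ?_
  rw [h, abs_mul, abs_mul, Nat.abs_cast, Nat.abs_cast]
  calc ((k + m).factorial : ℝ) * ((k.descFactorial m : ℝ) * |(a + a) ^ (k - m)|)
      ≤ (k.factorial * ((m + 1 : ℝ) * k) ^ m) * ((k : ℝ) ^ m * 2 ^ k) := by gcongr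
    _ = _ := by rw [mul_pow, two_mul, pow_add]; ring

open Polynomial in
theorem integral_mul_derivative (u v : ℝ[X]) :
    ∫ x in (-1 : ℝ)..1, (derivative u).eval x * v.eval x =
      u.eval 1 * v.eval 1 - u.eval (-1) * v.eval (-1) -
        ∫ x in (-1 : ℝ)..1, u.eval x * (derivative v).eval x := by
  have := intervalIntegral.integral_mul_deriv_eq_deriv_mul (a := (-1 : ℝ)) (b := 1)
    (u := fun x => v.eval x) (v := fun x => u.eval x)
    (u' := fun x => (derivative v).eval x) (v' := fun x => (derivative u).eval x)
    (fun x _ => v.hasDerivAt x) (fun x _ => u.hasDerivAt x)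
    ((derivative v).continuous.intervalIntegrable _ _)
    ((derivative u).continuous.intervalIntegrable _ _)
  simp only [mul_comm] at this ⊢
  exact this

open Polynomial in
theorem integral_iterate_derivative_mul (N : ℕ) (u v : ℝ[X]) :
    ∫ x in (-1 : ℝ)..1, (derivative^[N] u).eval x * v.eval x =
      ∑ i ∈ Finset.range N, (-1 : ℝ) ^ i *
        ((derivative^[N - 1 - i] u).eval 1 * (derivative^[i] v).eval 1 -
          (derivative^[N - 1 - i] u).eval (-1) * (derivative^[i] v).eval (-1)) +
      (-1 : ℝ) ^ N * ∫ x in (-1 : ℝ)..1, u.eval x * (derivative^[N] v).eval x := by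
  induction N generalizing v with
  | zero => simp
  | succ N ih =>
    rw [Function.iterate_succ_apply', integral_mul_derivative, ih, Finset.sum_range_succ']
    simp only [← Function.iterate_succ_apply derivative]
    have : ∀ i ∈ Finset.range N, (-1 : ℝ) ^ (i + 1) *
        ((derivative^[N + 1 - 1 - (i + 1)] u).eval 1 * (derivative^[i + 1] v).eval 1 -
          (derivative^[N + 1 - 1 - (i + 1)] u).eval (-1) * (derivative^[i + 1] v).eval (-1)) =
        - ((-1 : ℝ) ^ i *
        ((derivative^[N - 1 - i] u).eval 1 * (derivative^[i + 1] v).eval 1 -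
          (derivative^[N - 1 - i] u).eval (-1) * (derivative^[i + 1] v).eval (-1))) := by
      intro i hi
      rw [show N + 1 - 1 - (i + 1) = N - 1 - i by omega, pow_succ]
      ring
    rw [Finset.sum_congr rfl this, Finset.sum_neg_distrib]
    simp [pow_succ]
    ring

-- Integrate by parts `k + r` times, with `W = (X² - 1)^k`. The remaining integral vanishes since
-- `deg W = 2k < 2(k + r)`. Boundary terms with a derivative of `W` of order below `k` vanish at
-- `±1`, so only `r` of them survive; each is of order `k^{2(r-1-i)} k^{2(r+i)} = k^{4r-2}`,
-- whatever `i` is.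
open Polynomial in
theorem exists_integral_sq_iterate_derivative_rodrigues_le (r : ℕ) (hr : 1 ≤ r) :
    ∃ C : ℝ, 0 < C ∧ ∀ k : ℕ, 1 ≤ k →
      ∫ x in (-1 : ℝ)..1, ((derivative^[k + r] (((X : ℝ[X]) ^ 2 - 1) ^ k)).eval x) ^ 2 ≤
        C * (((2 : ℝ) ^ k * k.factorial) ^ 2 * (k : ℝ) ^ (4 * r - 2)) := by
  set b : ℕ → ℝ := fun m => (m + 1 : ℝ) ^ m
  have hb : ∀ m, 0 < b m := fun m => by positivity
  refine ⟨∑ i ∈ Finset.range r, 2 * (b (r - 1 - i) * b (r + i)),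
    Finset.sum_pos (fun i _ => by have := hb (r - 1 - i); have := hb (r + i); positivity)
      ⟨0, Finset.mem_range.2 hr⟩, fun k hk => ?_⟩
  set W : ℝ[X] := (X ^ 2 - 1) ^ k with hW
  have hone : ((1 : ℝ)) ^ 2 = 1 := by norm_num
  have hneg : (-1 : ℝ) ^ 2 = 1 := by norm_num
  have hzero : derivative^[k + r] (derivative^[k + r] W) = 0 := by
    rw [← Function.iterate_add_apply]
    refine iterate_derivative_eq_zero ?_
    have h2 : (X ^ 2 - 1 : ℝ[X]).natDegree ≤ 2 := by compute_degree
    have h1 : W.natDegree ≤ k * 2 := natDegree_pow_le_of_le k h2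
    omega
  have hsq : ∀ x : ℝ, ((derivative^[k + r] W).eval x) ^ 2 =
      (derivative^[k + r] W).eval x * (derivative^[k + r] W).eval x := fun x => sq _
  simp only [hsq]
  rw [integral_iterate_derivative_mul, hzero]
  simp only [eval_zero, mul_zero, intervalIntegral.integral_zero, add_zero]
  rw [add_comm k r, Finset.sum_range_add]
  have hvan : ∀ i ∈ Finset.range k, (-1 : ℝ) ^ (r + i) *
      ((derivative^[r + k - 1 - (r + i)] W).eval 1 *
          (derivative^[r + i] (derivative^[r + k] W)).eval 1 -
        (derivative^[r + k - 1 - (r + i)] W).eval (-1) *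
          (derivative^[r + i] (derivative^[r + k] W)).eval (-1)) = 0 := by
    intro i hi
    have hlt : r + k - 1 - (r + i) < k := by omega
    have e1 : (derivative^[r + k - 1 - (r + i)] W).eval 1 = 0 := by
      rw [hW, X_sq_sub_one_pow_eq k hone]
      exact eval_iterate_derivative_eq_zero_of_lt _ hlt _
    have e2 : (derivative^[r + k - 1 - (r + i)] W).eval (-1) = 0 := by
      rw [hW, X_sq_sub_one_pow_eq k hneg]
      exact eval_iterate_derivative_eq_zero_of_lt _ hlt _
    rw [e1, e2]; ring
  rw [Finset.sum_eq_zero hvan, add_zero, Finset.sum_mul]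
  refine Finset.sum_le_sum fun i hi => ?_
  have hi' := Finset.mem_range.1 hi
  rw [← Function.iterate_add_apply, show r + k - 1 - i = k + (r - 1 - i) by omega,
    show i + (r + k) = k + (r + i) by omega]
  set M : ℝ := (2 : ℝ) ^ k * k.factorial
  have hprod : ∀ a : ℝ, a ^ 2 = 1 → |(derivative^[k + (r - 1 - i)] W).eval a *
      (derivative^[k + (r + i)] W).eval a| ≤
      b (r - 1 - i) * b (r + i) * (M ^ 2 * (k : ℝ) ^ (4 * r - 2)) := by
    intro a ha
    rw [abs_mul]
    calc _ ≤ (M * (b (r - 1 - i) * (k : ℝ) ^ (2 * (r - 1 - i)))) *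
          (M * (b (r + i) * (k : ℝ) ^ (2 * (r + i)))) := by
          have h1 := abs_eval_iterate_derivative_rodrigues_le k (r - 1 - i) hk ha
          have h2 := abs_eval_iterate_derivative_rodrigues_le k (r + i) hk ha
          exact mul_le_mul h1 h2 (abs_nonneg _) ((abs_nonneg _).trans h1)
      _ = _ := by
          rw [show 4 * r - 2 = 2 * (r - 1 - i) + 2 * (r + i) by omega, pow_add]
          ring
  refine (le_abs_self _).trans ?_
  rw [abs_mul, abs_pow, abs_neg, abs_one, one_pow, one_mul]
  refine (abs_sub _ _).trans ?_
  have := hprod 1 hone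
  have := hprod (-1) hneg
  linarith

open Polynomial in
theorem exists_integral_sq_iterate_derivative_phi_le (r : ℕ) (hr : 1 ≤ r) :
    ∃ C : ℝ, 0 < C ∧ ∀ k : ℕ, 1 ≤ k →
      ∫ x in (-1 : ℝ)..1, ((derivative^[r] (phi k)).eval x) ^ 2 ≤
        C * (k : ℝ) ^ (4 * r - 1) := by
  obtain ⟨C, hC, h⟩ := exists_integral_sq_iterate_derivative_rodrigues_le r hr
  refine ⟨2 * C, by positivity, fun k hk => ?_⟩
  have hk' : (1 : ℝ) ≤ k := by exact_mod_cast hk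
  set M : ℝ := (2 : ℝ) ^ k * k.factorial
  have hM : 0 < M := by positivity
  have hphi : ∀ x : ℝ, ((derivative^[r] (phi k)).eval x) ^ 2 = ((k : ℝ) + 1 / 2) * (M⁻¹) ^ 2 *
      ((derivative^[k + r] (((X : ℝ[X]) ^ 2 - 1) ^ k)).eval x) ^ 2 := by
    intro x
    rw [phi, iterate_derivative_C_mul, eval_mul, eval_C, ← Function.iterate_add_apply,
      add_comm r k, mul_pow, mul_pow, Real.sq_sqrt (by positivity)]
  simp only [hphi]
  rw [intervalIntegral.integral_const_mul]
  calc _ ≤ ((k : ℝ) + 1 / 2) * (M⁻¹) ^ 2 * (C * (M ^ 2 * (k : ℝ) ^ (4 * r - 2))) := by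
        gcongr
        exact h k hk
    _ = ((k : ℝ) + 1 / 2) * C * (k : ℝ) ^ (4 * r - 2) := by field_simp
    _ ≤ (2 * k) * C * (k : ℝ) ^ (4 * r - 2) := by gcongr; linarith
    _ = _ := by
        rw [show 4 * r - 1 = (4 * r - 2) + 1 by omega, pow_succ]; ring

theorem norm_tensor_sq (u v : Polynomial ℝ) :
    ‖tensor u v‖ ^ 2 =
      (∫ x in (-1 : ℝ)..1, (u.eval x) ^ 2) * ∫ x in (-1 : ℝ)..1, (v.eval x) ^ 2 := by
  rw [← real_inner_self_eq_norm_sq, L2.inner_def]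
  have hae := (memLp_tensor u v).coeFn_toLp
  calc ∫ z, inner ℝ (tensor u v z) (tensor u v z) ∂((volume : Measure (ℝ × ℝ)).restrict Q)
      = ∫ z, (u.eval z.1) ^ 2 * (v.eval z.2) ^ 2 ∂((volume : Measure (ℝ × ℝ)).restrict Q) := by
        refine integral_congr_ae ?_
        filter_upwards [hae] with z hz
        rw [tensor, hz]
        simp only [RCLike.inner_apply, conj_trivial]
        ring
    _ = ∫ z, (u.eval z.1) ^ 2 * (v.eval z.2) ^ 2 ∂(((volume : Measure ℝ).restrict
          (Set.Icc (-1) 1)).prod ((volume : Measure ℝ).restrict (Set.Icc (-1) 1))) := by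
        rw [Measure.prod_restrict, Q, Measure.volume_eq_prod]
    _ = _ := by
        rw [integral_prod_mul (fun x => (u.eval x) ^ 2) (fun x => (v.eval x) ^ 2),
          intervalIntegral.integral_of_le (by norm_num), intervalIntegral.integral_of_le (by norm_num),
          integral_Icc_eq_integral_Ioc, integral_Icc_eq_integral_Ioc]

theorem exists_norm_dphi_le (r : ℕ) (hr : 1 ≤ r) :
    ∃ C : ℝ, 0 < C ∧ ∀ q : ℕ × ℕ, 1 ≤ q.1 → 1 ≤ q.2 →
      ‖dphi r q‖ ≤ C * ((q.1 : ℝ) * q.2) ^ (2 * (r : ℝ) - 1 / 2) := by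
  obtain ⟨C, hC, h⟩ := exists_integral_sq_iterate_derivative_phi_le r hr
  refine ⟨C, hC, fun q h1 h2 => ?_⟩
  have hq1 : (0 : ℝ) < q.1 := by exact_mod_cast h1
  have hq2 : (0 : ℝ) < q.2 := by exact_mod_cast h2
  refine le_of_sq_le_sq ?_ (by positivity)
  rw [dphi, norm_tensor_sq, mul_pow, ← Real.rpow_natCast _ 2, ← Real.rpow_natCast _ 2,
    ← Real.rpow_mul (by positivity)]
  have he : (2 * (r : ℝ) - 1 / 2) * ((2 : ℕ) : ℝ) = ((4 * r - 1 : ℕ) : ℝ) := by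
    rw [Nat.cast_sub (by omega)]; push_cast; ring
  rw [he, Real.rpow_natCast, Real.rpow_natCast]
  have hn : 0 ≤ ∫ x in (-1 : ℝ)..1,
      ((Polynomial.derivative^[r] (phi q.2)).eval x) ^ 2 :=
    intervalIntegral.integral_nonneg (by norm_num) fun _ _ => sq_nonneg _
  refine (mul_le_mul (h _ h1) (h _ h2) hn (by positivity)).trans (le_of_eq ?_)
  rw [mul_pow]; ring


/-! ### Hölder bounds for coefficients and noise; the cross. -/

theorem sum_normTerm_le_one {s μ : ℝ} (hs : 1 ≤ s) {f : L2Q} (hf : f ∈ unitBall s μ)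
    (T : Finset (ℕ × ℕ)) : ∑ q ∈ T, normTerm s μ f q ≤ 1 := by
  have hnn : ∀ q, 0 ≤ normTerm s μ f q := fun q => by unfold normTerm; positivity
  refine (hf.1.sum_le_tsum T fun q _ => hnn q).trans ?_
  by_contra h
  exact absurd hf.2 (not_le.2 (Real.one_lt_rpow (not_le.1 h) (by positivity)))

/-- Hölder with weight `(kj)^{-γ}`: the weight sums to `N^{1-γ} (1 + ln N)` up to a constant, while
the other factor is `N^{-e}` times a partial sum of `‖f‖_{s,μ}^s`. The weighted form covers `s = 1`
without a separate case, and `γ` cancels from the final exponent. -/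
theorem exists_sum_coeff_tail_le {s μ η : ℝ} (hs : 1 ≤ s) (h : η + 1 - 1 / s < μ) :
    ∃ C : ℝ, 0 < C ∧ ∀ f ∈ unitBall s μ, ∀ N : ℕ, 1 ≤ N → ∀ T : Finset (ℕ × ℕ),
      (∀ q ∈ T, 1 ≤ q.1 ∧ 1 ≤ q.2 ∧ N ≤ q.1 * q.2) →
      ∑ q ∈ T, |coeff f q| * ((q.1 : ℝ) * q.2) ^ η ≤
        C * ((N : ℝ) ^ (-(μ - η - 1 + 1 / s)) * (1 + Real.log N) ^ (1 - 1 / s)) := by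
  have hs0 : 0 < s := by linarith
  set D : ℝ := μ - (η + 1 - 1 / s) with hD
  have hD0 : 0 < D := by linarith
  -- Any exponent `γ > 1` with `(s - 1) γ ≤ s (μ - η)` serves as weight
  set γ : ℝ := 1 + D with hγdef
  have hγ : 1 < γ := by linarith
  obtain ⟨C, hC, hsum⟩ := exists_sum_hyperbolic_tail_le hγ
  refine ⟨C ^ (1 - s⁻¹), by positivity, fun f hf N hN T hT => ?_⟩
  have hN0 : (0 : ℝ) < N := by exact_mod_cast hN
  have hlog : 0 ≤ Real.log N := Real.log_natCast_nonneg N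
  have hs1 : 0 ≤ 1 - s⁻¹ := sub_nonneg.2 (inv_le_one_of_one_le₀ hs)
  -- The power of `kj` left over after extracting `normTerm`; with this `γ` it equals `D`. Its sign
  -- permits replacing `(kj)^{-e}` by `N^{-e}`.
  set e : ℝ := s * (μ - η - γ) + γ with he
  have he0 : 0 ≤ e := by
    have h1 : s * (1 / s) = 1 := by field_simp
    have h2 : e = s * D + s - s * (1 / s) - s * γ + γ := by rw [he, hD]; ring
    rw [h2, h1, hγdef]; nlinarith
  have hx : ∀ q ∈ T, (0 : ℝ) < (q.1 : ℝ) * q.2 := fun q hq => by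
    obtain ⟨h1, h2, -⟩ := hT q hq
    have : 0 < q.1 * q.2 := by positivity
    exact_mod_cast this
  have hxN : ∀ q ∈ T, (N : ℝ) ≤ (q.1 : ℝ) * q.2 := fun q hq => by
    exact_mod_cast (hT q hq).2.2
  have hH := Real.inner_le_weight_mul_Lp_of_nonneg T hs
    (fun q : ℕ × ℕ => ((q.1 : ℝ) * q.2) ^ (-γ))
    (fun q => |coeff f q| * ((q.1 : ℝ) * q.2) ^ (η + γ))
    (fun q => by positivity) (fun q => by positivity)
  have hL : ∑ q ∈ T, |coeff f q| * ((q.1 : ℝ) * q.2) ^ η = ∑ q ∈ T,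
      ((q.1 : ℝ) * q.2) ^ (-γ) * (|coeff f q| * ((q.1 : ℝ) * q.2) ^ (η + γ)) := by
    refine Finset.sum_congr rfl fun q hq => ?_
    rw [mul_left_comm, ← Real.rpow_add (hx q hq)]
    congr 2; ring
  have hR : ∑ q ∈ T, ((q.1 : ℝ) * q.2) ^ (-γ) *
      (|coeff f q| * ((q.1 : ℝ) * q.2) ^ (η + γ)) ^ s ≤ (N : ℝ) ^ (-e) := by
    calc _ ≤ ∑ q ∈ T, (N : ℝ) ^ (-e) * normTerm s μ f q := by
          refine Finset.sum_le_sum fun q hq => ?_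
          have hxq := hx q hq
          rw [Real.mul_rpow (abs_nonneg _) (by positivity), ← Real.rpow_mul hxq.le]
          have h1 : ((q.1 : ℝ) * q.2) ^ (-γ) * (|coeff f q| ^ s *
              ((q.1 : ℝ) * q.2) ^ ((η + γ) * s)) =
              ((q.1 : ℝ) * q.2) ^ (-e) * (((q.1 : ℝ) * q.2) ^ (s * μ) * |coeff f q| ^ s) := by
            rw [mul_left_comm, ← mul_assoc, mul_assoc, ← Real.rpow_add hxq,
              ← mul_assoc, ← Real.rpow_add hxq, mul_comm]
            congr 2; rw [he]; ring
          rw [h1, normTerm, max_eq_right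
            ((by exact_mod_cast hN : (1 : ℝ) ≤ N).trans (hxN q hq))]
          gcongr ?_ * _
          exact Real.rpow_le_rpow_of_nonpos hN0 (hxN q hq) (by linarith)
      _ ≤ (N : ℝ) ^ (-e) * 1 := by
          rw [← Finset.mul_sum]
          gcongr
          exact sum_normTerm_le_one hs hf T
      _ = _ := mul_one _
  rw [hL]
  refine hH.trans ?_
  calc _ ≤ (C * ((N : ℝ) ^ (1 - γ) * (1 + Real.log N))) ^ (1 - s⁻¹) * ((N : ℝ) ^ (-e)) ^ s⁻¹ := by
        gcongr
        exact hsum N hN T hT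
    _ = _ := by
        rw [Real.mul_rpow hC.le (by positivity), Real.mul_rpow (by positivity) (by positivity),
          ← Real.rpow_mul hN0.le, ← Real.rpow_mul hN0.le, one_div]
        have : (N : ℝ) ^ (-(μ - η - 1 + s⁻¹)) =
            (N : ℝ) ^ ((1 - γ) * (1 - s⁻¹)) * (N : ℝ) ^ (-e * s⁻¹) := by
          rw [← Real.rpow_add hN0]
          congr 1
          have h1 : s * s⁻¹ = 1 := mul_inv_cancel₀ hs0.ne'
          rw [he]; linear_combination (μ - η - γ) * h1
        rw [this]; ring

theorem toReal_one_div_mem_Icc {p : ℝ≥0∞} (hp : 1 ≤ p) : (1 / p).toReal ∈ Set.Icc (0 : ℝ) 1 := by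
  refine ⟨ENNReal.toReal_nonneg, ?_⟩
  have : 1 / p ≤ 1 := by rw [one_div]; exact ENNReal.inv_le_one.2 hp
  simpa using ENNReal.toReal_mono ENNReal.one_ne_top this

theorem sum_abs_le_card_rpow_mul_norm {ι : Type*} {p : ℝ≥0∞} (hp : 1 ≤ p)
    (ξ : lp (fun _ : ι => ℝ) p) (T : Finset ι) :
    ∑ q ∈ T, |ξ q| ≤ (T.card : ℝ) ^ (1 - (1 / p).toReal) * ‖ξ‖ := by
  rcases eq_or_ne p ⊤ with rfl | hpt
  · have : ∑ q ∈ T, |ξ q| ≤ ∑ _q ∈ T, ‖ξ‖ :=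
      Finset.sum_le_sum fun q _ => lp.norm_apply_le_norm (by simp) ξ q
    simpa using this
  · have hp1 : 1 ≤ p.toReal := by simpa using ENNReal.toReal_mono hpt hp
    have hp0 : 0 < p.toReal := by linarith
    have h := Real.inner_le_weight_mul_Lp_of_nonneg T hp1 (fun _ => 1) (fun q => |ξ q|)
      (fun _ => zero_le_one) (fun q => abs_nonneg _)
    have hn := Real.rpow_le_rpow (Finset.sum_nonneg fun q _ => by positivity)
      (lp.sum_rpow_le_norm_rpow hp0 ξ T) (inv_nonneg.2 hp0.le)
    have : 0 ≤ ‖ξ‖ := lp.norm_nonneg' ξ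
    rw [← Real.rpow_mul this, mul_inv_cancel₀ hp0.ne', Real.rpow_one] at hn
    simp only [one_mul, Finset.sum_const, nsmul_eq_mul, mul_one] at h
    rw [one_div, ENNReal.toReal_inv]
    refine h.trans ?_
    gcongr
    exact hn

/-- The bounds `k, j ≤ n - 1` are redundant: `k ≥ n` and `j ≥ r` would already force `kj ≥ rn`.
Hence every omitted index of the series has `kj ≥ rn`. -/
theorem mem_cross_iff {r n : ℕ} {q : ℕ × ℕ} (h1 : r ≤ q.1) (h2 : r ≤ q.2) :
    q ∈ cross r n ↔ q.1 * q.2 < r * n := by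
  simp only [cross, Finset.mem_filter, Finset.mem_product, Finset.mem_Ico]
  constructor
  · rintro ⟨-, h⟩; omega
  · intro h
    have h3 : q.1 < n := lt_of_not_ge fun h4 => by nlinarith [Nat.mul_le_mul h4 h2]
    have h4 : q.2 < n := lt_of_not_ge fun h5 => by nlinarith [Nat.mul_le_mul h1 h5]
    exact ⟨⟨⟨h1, h3⟩, h2, h4⟩, h⟩

theorem norm_sub_sum_le_of_forall_disjoint {ι E : Type*} [NormedAddCommGroup E] {g : ι → E}
    {a : E} (hg : HasSum g a) (S : Finset ι) {B : ℝ}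
    (h : ∀ T : Finset ι, Disjoint S T → ∑ i ∈ T, ‖g i‖ ≤ B) : ‖a - ∑ i ∈ S, g i‖ ≤ B := by
  classical
  have ht : Filter.Tendsto (fun T : Finset ι => ‖∑ i ∈ T, g i - ∑ i ∈ S, g i‖) Filter.atTop
      (nhds ‖a - ∑ i ∈ S, g i‖) := (Filter.Tendsto.sub_const hg _).norm
  refine le_of_tendsto ht ((Filter.eventually_ge_atTop S).mono fun T hT => ?_)
  rw [← Finset.sum_sdiff hT, add_sub_cancel_right]
  exact (norm_sum_le _ _).trans (h _ Finset.disjoint_sdiff)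

/-! ### Truncation error and propagated data error. -/

theorem exists_sum_norm_derivTerm_le {r : ℕ} (hr : 1 ≤ r) {s μ : ℝ} (hs : 1 ≤ s)
    (hμ : 2 * (r : ℝ) - 1 / s + 1 / 2 < μ) :
    ∃ C : ℝ, 0 < C ∧ ∀ f ∈ unitBall s μ, ∀ N : ℕ, 1 ≤ N →
      ∀ T : Finset {q : ℕ × ℕ // r ≤ q.1 ∧ r ≤ q.2}, (∀ q ∈ T, N ≤ q.1.1 * q.1.2) →
      ∑ q ∈ T, ‖derivTerm r f q‖ ≤ C * ((N : ℝ) ^ (-(μ - 2 * (r : ℝ) + 1 / s - 1 / 2)) *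
        (1 + Real.log N) ^ (1 - 1 / s)) := by
  obtain ⟨C₁, hC₁, h₁⟩ := exists_norm_dphi_le r hr
  obtain ⟨C₂, hC₂, h₂⟩ := exists_sum_coeff_tail_le (s := s) (μ := μ) (η := 2 * (r : ℝ) - 1 / 2)
    hs (by linarith)
  refine ⟨C₁ * C₂, by positivity, fun f hf N hN T hT => ?_⟩
  have h := h₂ f hf N hN (T.map (Function.Embedding.subtype _)) (by
    intro q hq
    obtain ⟨q, hqT, rfl⟩ := Finset.mem_map.1 hq
    exact ⟨hr.trans q.2.1, hr.trans q.2.2, hT q hqT⟩)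
  rw [Finset.sum_map, show -(μ - (2 * (r : ℝ) - 1 / 2) - 1 + 1 / s) =
    -(μ - 2 * (r : ℝ) + 1 / s - 1 / 2) by ring] at h
  rw [mul_assoc]
  refine le_trans ?_ (mul_le_mul_of_nonneg_left h hC₁.le)
  rw [Finset.mul_sum]
  refine Finset.sum_le_sum fun q _ => ?_
  rw [derivTerm, norm_smul, Real.norm_eq_abs, mul_left_comm]
  exact mul_le_mul_of_nonneg_left (h₁ q.1 (hr.trans q.2.1) (hr.trans q.2.2)) (abs_nonneg _)

theorem summable_derivTerm {r : ℕ} (hr : 1 ≤ r) {s μ : ℝ} (hs : 1 ≤ s)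
    (hμ : 2 * (r : ℝ) - 1 / s + 1 / 2 < μ) {f : L2Q} (hf : f ∈ unitBall s μ) :
    Summable (derivTerm r f) := by
  obtain ⟨C, -, h⟩ := exists_sum_norm_derivTerm_le hr hs hμ
  -- With `N = 1` the tail estimate covers every finite set of indices, since `r ≥ 1` makes `kj ≥
  -- 1`.
  refine Summable.of_norm (summable_of_sum_le (fun _ => norm_nonneg _) fun T =>
    h f hf 1 le_rfl T fun q _ => ?_)
  exact Nat.mul_pos (hr.trans q.2.1) (hr.trans q.2.2)

theorem exists_norm_mixedDeriv_sub_truncation_coeff_le {r : ℕ} (hr : 1 ≤ r) {s μ : ℝ} (hs : 1 ≤ s)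
    (hμ : 2 * (r : ℝ) - 1 / s + 1 / 2 < μ) :
    ∃ C : ℝ, 0 < C ∧ ∀ f ∈ unitBall s μ, ∀ n : ℕ, 1 ≤ n →
      ‖mixedDeriv r f - truncation r n (coeff f)‖ ≤
        C * (((r * n : ℕ) : ℝ) ^ (-(μ - 2 * (r : ℝ) + 1 / s - 1 / 2)) *
          (1 + Real.log ((r * n : ℕ) : ℝ)) ^ (1 - 1 / s)) := by
  obtain ⟨C, hC, h⟩ := exists_sum_norm_derivTerm_le hr hs hμ
  refine ⟨C, hC, fun f hf n hn => ?_⟩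
  have hsub : truncation r n (coeff f) =
      ∑ q ∈ (cross r n).subtype (fun q : ℕ × ℕ => r ≤ q.1 ∧ r ≤ q.2), derivTerm r f q := by
    unfold derivTerm truncation
    rw [Finset.sum_subtype_of_mem (fun q => coeff f q • dphi r q)]
    intro q hq
    simp only [cross, Finset.mem_filter, Finset.mem_product, Finset.mem_Ico] at hq
    exact ⟨hq.1.1.1, hq.1.2.1⟩
  rw [hsub]
  refine norm_sub_sum_le_of_forall_disjoint (summable_derivTerm hr hs hμ hf).hasSum _
    fun T hT => h f hf (r * n) (Nat.mul_pos hr hn) T fun q hq => ?_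
  have hq' := Finset.disjoint_right.1 hT hq
  rw [Finset.mem_subtype, mem_cross_iff q.2.1 q.2.2] at hq'
  exact not_lt.1 hq'

theorem exists_norm_truncation_sub_le {r : ℕ} (hr : 1 ≤ r) {p : ℝ≥0∞} (hp : 1 ≤ p) :
    ∃ C : ℝ, 0 < C ∧ ∀ (f : L2Q) (δ : ℝ) (y : ℕ × ℕ → ℝ) (n : ℕ), IsPerturbation p δ f y →
      ‖truncation r n (coeff f) - truncation r n y‖ ≤
        C * (((r * n : ℕ) : ℝ) ^ (2 * (r : ℝ) - 1 / 2) *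
          (((r * n : ℕ) : ℝ) * (1 + Real.log ((r * n : ℕ) : ℝ))) ^ (1 - (1 / p).toReal) * δ) := by
  obtain ⟨C, hC, h⟩ := exists_norm_dphi_le r hr
  refine ⟨C, hC, fun f δ y n ⟨ξ, hξ, hδ⟩ => ?_⟩
  set N : ℕ := r * n with hN
  have hr' : (1 : ℝ) ≤ r := by exact_mod_cast hr
  have hη : 0 ≤ 2 * (r : ℝ) - 1 / 2 := by linarith
  have hP := toReal_one_div_mem_Icc hp
  have hmem : ∀ q ∈ cross r n, 1 ≤ q.1 ∧ 1 ≤ q.2 ∧ q.1 * q.2 ≤ N := by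
    intro q hq
    simp only [cross, Finset.mem_filter, Finset.mem_product, Finset.mem_Ico] at hq
    exact ⟨hr.trans hq.1.1.1, hr.trans hq.1.2.1, by omega⟩
  have hterm : ∀ q ∈ cross r n, ‖ξ q • dphi r q‖ ≤
      C * (N : ℝ) ^ (2 * (r : ℝ) - 1 / 2) * |ξ q| := by
    intro q hq
    obtain ⟨h1, h2, h3⟩ := hmem q hq
    have h3' : (q.1 : ℝ) * q.2 ≤ N := by exact_mod_cast h3
    rw [norm_smul, Real.norm_eq_abs, mul_comm]
    gcongr
    exact (h q h1 h2).trans (by gcongr)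
  have hlog : 0 ≤ Real.log N := Real.log_natCast_nonneg N
  have heq : truncation r n (coeff f) - truncation r n y = ∑ q ∈ cross r n, ξ q • dphi r q := by
    rw [truncation, truncation, ← Finset.sum_sub_distrib]
    exact Finset.sum_congr rfl fun q _ => by rw [hξ, sub_smul]
  rw [heq]
  calc _ ≤ ∑ q ∈ cross r n, C * (N : ℝ) ^ (2 * (r : ℝ) - 1 / 2) * |ξ q| :=
        (norm_sum_le _ _).trans (Finset.sum_le_sum hterm)
    _ = C * (N : ℝ) ^ (2 * (r : ℝ) - 1 / 2) * ∑ q ∈ cross r n, |ξ q| := by rw [Finset.mul_sum]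
    _ ≤ C * (N : ℝ) ^ (2 * (r : ℝ) - 1 / 2) *
        ((N * (1 + Real.log N)) ^ (1 - (1 / p).toReal) * δ) := by
        gcongr
        refine (sum_abs_le_card_rpow_mul_norm hp ξ _).trans ?_
        have hn0 : 0 ≤ ‖ξ‖ := lp.norm_nonneg' ξ
        have hc := card_hyperbolic_le N (cross r n) hmem
        have : 0 ≤ 1 - (1 / p).toReal := sub_nonneg.2 hP.2
        gcongr
    _ = _ := by ring

/-! ### Balancing the two errors. -/

/-- Here `exp L` plays the role of `1/δ`, so `ln N` is at most linear in `L` and `ln L`. The bound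
`L ≥ L₀ > 0` absorbs the additive constants into a multiple of `L`. -/
theorem exists_one_add_log_le {L₀ κ a b : ℝ} (hL₀ : 0 < L₀) (hκ : 0 < κ) (hb : 0 < b) :
    ∃ A : ℝ, 0 < A ∧ ∀ L N : ℝ, L₀ ≤ L → 0 < N →
      N ≤ b * (Real.exp L * L ^ a) ^ (1 / κ) → 1 + Real.log N ≤ A * L := by
  refine ⟨(1 + |Real.log b| + |a| / κ * |Real.log L₀|) / L₀ + (1 + |a|) / κ, by positivity,
    fun L N hL hN hle => ?_⟩
  have hL' : 0 < L := hL₀.trans_le hL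
  have h1 : Real.log N ≤ Real.log b + 1 / κ * (L + a * Real.log L) := by
    refine (Real.log_le_log hN hle).trans (le_of_eq ?_)
    rw [Real.log_mul hb.ne' (by positivity), Real.log_rpow (by positivity),
      Real.log_mul (by positivity) (by positivity), Real.log_exp, Real.log_rpow hL']
  have h2 : |Real.log L| ≤ L + |Real.log L₀| := by
    refine abs_le.2 ⟨?_, ?_⟩
    · have := Real.log_le_log hL₀ hL
      have := neg_abs_le (Real.log L₀)
      linarith
    · have := Real.log_le_self hL'.le
      have := abs_nonneg (Real.log L₀)
      linarith
  have h3 : a * Real.log L ≤ |a| * (L + |Real.log L₀|) :=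
    (le_abs_self _).trans (by rw [abs_mul]; gcongr)
  have h4 : 1 / κ * (L + a * Real.log L) ≤ 1 / κ * (L + |a| * (L + |Real.log L₀|)) := by gcongr
  have h5 : 1 + |Real.log b| + |a| / κ * |Real.log L₀| ≤
      (1 + |Real.log b| + |a| / κ * |Real.log L₀|) / L₀ * L := by
    rw [mul_comm_div (1 + |Real.log b| + _)]
    exact le_mul_of_one_le_right (by positivity) ((one_le_div hL₀).2 hL)
  have h6 : 1 / κ * (L + |a| * (L + |Real.log L₀|)) =
      (1 + |a|) / κ * L + |a| / κ * |Real.log L₀| := by ring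
  have := le_abs_self (Real.log b)
  rw [add_mul]
  linarith

/-- The lower bound on `n` is what matters, since `N` enters with the negative power `-ρ`. The
estimate really yields `L^{1-S}`; the spare `L^{-1/2}` is bounded by `L₀^{-1/2}`. -/
theorem truncation_term_le {ρ S A L₀ L c₁ Y n N : ℝ} (hρ : 0 ≤ ρ) (hS : S ≤ 1) (hA : 0 < A)
    (hL₀ : 0 < L₀) (hL : L₀ ≤ L) (hc₁ : 0 < c₁) (hY : 0 < Y) (hn : c₁ * Y ≤ n) (hnN : n ≤ N)
    (hN : 0 ≤ 1 + Real.log N) (hlog : 1 + Real.log N ≤ A * L) :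
    N ^ (-ρ) * (1 + Real.log N) ^ (1 - S) ≤
      c₁ ^ (-ρ) * A ^ (1 - S) * L₀ ^ (-(1 / 2) : ℝ) * (Y ^ (-ρ) * L ^ (3 / 2 - S)) := by
  have hL' : 0 < L := hL₀.trans_le hL
  have h0 : 0 ≤ N := by nlinarith [mul_pos hc₁ hY]
  calc N ^ (-ρ) * (1 + Real.log N) ^ (1 - S)
      ≤ (c₁ * Y) ^ (-ρ) * (A * L) ^ (1 - S) := by
        have h1 := Real.rpow_le_rpow_of_nonpos (mul_pos hc₁ hY) (hn.trans hnN)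
          (neg_nonpos.2 hρ)
        have h2 : 0 ≤ 1 - S := by linarith
        gcongr
    _ = c₁ ^ (-ρ) * A ^ (1 - S) * Y ^ (-ρ) * (L ^ (-(1 / 2) : ℝ) * L ^ (3 / 2 - S)) := by
        rw [Real.mul_rpow hc₁.le hY.le, Real.mul_rpow hA.le hL'.le, ← Real.rpow_add hL',
          show -(1 / 2) + (3 / 2 - S) = 1 - S by ring]
        ring
    _ ≤ c₁ ^ (-ρ) * A ^ (1 - S) * Y ^ (-ρ) * (L₀ ^ (-(1 / 2) : ℝ) * L ^ (3 / 2 - S)) := by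
        have := Real.rpow_le_rpow_of_nonpos hL₀ hL (z := -(1 / 2)) (by norm_num)
        gcongr
    _ = _ := by ring

/-- The upper bound on `N` is what matters. Writing `δ = Y^{-κ} L^{P-S}` turns `Y^{η+1-P} L^{1-P} δ`
into `Y^{-ρ} L^{1-S}`, the same order as the truncation error. -/
theorem perturbation_term_le {ρ κ η S P A L₀ L b Y δ N : ℝ} (hη : 0 ≤ η) (hP : P ≤ 1)
    (hκ : κ - ρ = η + 1 - P) (hA : 0 < A) (hL₀ : 0 < L₀) (hL : L₀ ≤ L) (hb : 0 < b) (hY : 0 < Y)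
    (hδ : δ = Y ^ (-κ) * L ^ (P - S)) (hN0 : 0 < N) (hN : N ≤ b * Y)
    (hlog0 : 0 ≤ 1 + Real.log N) (hlog : 1 + Real.log N ≤ A * L) :
    N ^ η * (N * (1 + Real.log N)) ^ (1 - P) * δ ≤
      b ^ (η + 1 - P) * A ^ (1 - P) * L₀ ^ (-(1 / 2) : ℝ) * (Y ^ (-ρ) * L ^ (3 / 2 - S)) := by
  have hL' : 0 < L := hL₀.trans_le hL
  have hP' : 0 ≤ 1 - P := by linarith
  have hE : 0 ≤ η + 1 - P := by linarith
  have hδ0 : 0 ≤ δ := by rw [hδ]; positivity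
  calc N ^ η * (N * (1 + Real.log N)) ^ (1 - P) * δ
      = N ^ (η + 1 - P) * (1 + Real.log N) ^ (1 - P) * δ := by
        rw [Real.mul_rpow hN0.le hlog0, ← mul_assoc, ← Real.rpow_add hN0,
          show η + (1 - P) = η + 1 - P by ring]
    _ ≤ (b * Y) ^ (η + 1 - P) * (A * L) ^ (1 - P) * δ := by gcongr
    _ = b ^ (η + 1 - P) * A ^ (1 - P) * Y ^ (-ρ) * (L ^ (-(1 / 2) : ℝ) * L ^ (3 / 2 - S)) := by
        have h1 : Y ^ (-ρ) = Y ^ (η + 1 - P) * Y ^ (-κ) := by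
          rw [← Real.rpow_add hY]; congr 1; linarith
        have h2 : L ^ (-(1 / 2) : ℝ) * L ^ (3 / 2 - S) = L ^ (1 - P) * L ^ (P - S) := by
          rw [← Real.rpow_add hL', ← Real.rpow_add hL']; congr 1; ring
        rw [h1, h2, hδ, Real.mul_rpow hb.le hY.le, Real.mul_rpow hA.le hL'.le]
        ring
    _ ≤ b ^ (η + 1 - P) * A ^ (1 - P) * Y ^ (-ρ) * (L₀ ^ (-(1 / 2) : ℝ) * L ^ (3 / 2 - S)) := by
        have := Real.rpow_le_rpow_of_nonpos hL₀ hL (z := -(1 / 2)) (by norm_num)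
        gcongr
    _ = _ := by ring

end LegendreDiff

end

theorem theorem1 (r : ℕ) (hr : 1 ≤ r) (s μ : ℝ) (hs : 1 ≤ s)
    (hμ : 2 * (r : ℝ) - 1 / s + 1 / 2 < μ)
    (p : ℝ≥0∞) (hp : 1 ≤ p) :
    (∀ f ∈ LegendreDiff.unitBall s μ, Summable (LegendreDiff.derivTerm r f)) ∧
    ∀ (δ₀ c₁ c₂ : ℝ), 0 < δ₀ → δ₀ < 1 → 0 < c₁ → 0 < c₂ →
      ∃ c : ℝ, 0 < c ∧
        ∀ (f : LegendreDiff.L2Q) (δ : ℝ) (y : ℕ × ℕ → ℝ) (n : ℕ),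
          f ∈ LegendreDiff.unitBall s μ → 0 < δ → δ ≤ δ₀ →
          LegendreDiff.IsPerturbation p δ f y →
          c₁ * (δ⁻¹ * Real.log (1 / δ) ^ ((1 / p).toReal - 1 / s)) ^
              (1 / (μ - (1 / p).toReal + 1 / s)) ≤ (n : ℝ) →
          (n : ℝ) ≤ c₂ * (δ⁻¹ * Real.log (1 / δ) ^ ((1 / p).toReal - 1 / s)) ^
              (1 / (μ - (1 / p).toReal + 1 / s)) →
          ‖LegendreDiff.mixedDeriv r f - LegendreDiff.truncation r n y‖ ≤
            c * (δ * Real.log (1 / δ) ^ (1 / s - (1 / p).toReal)) ^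
                ((μ - 2 * (r : ℝ) + 1 / s - 1 / 2) / (μ - (1 / p).toReal + 1 / s)) *
              Real.log (1 / δ) ^ (3 / 2 - 1 / s) := by
  refine ⟨fun f hf => LegendreDiff.summable_derivTerm hr hs hμ hf, ?_⟩
  intro δ₀ c₁ c₂ hδ₀ hδ₀1 hc₁ hc₂
  have hr' : (1 : ℝ) ≤ r := by exact_mod_cast hr
  have hS0 : 0 < 1 / s := by positivity
  have hS1 : 1 / s ≤ 1 := by rw [one_div]; exact inv_le_one_of_one_le₀ hs
  obtain ⟨hP0, hP1⟩ := LegendreDiff.toReal_one_div_mem_Icc hp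
  obtain ⟨C₁, hC₁, h₁⟩ := LegendreDiff.exists_norm_mixedDeriv_sub_truncation_coeff_le hr hs hμ
  obtain ⟨C₂, hC₂, h₂⟩ := LegendreDiff.exists_norm_truncation_sub_le hr hp
  set S : ℝ := 1 / s
  set P : ℝ := (1 / p).toReal
  set κ : ℝ := μ - P + S with hκdef
  set ρ : ℝ := μ - 2 * (r : ℝ) + S - 1 / 2 with hρdef
  have hρ : 0 < ρ := by linarith
  have hκ : 0 < κ := by linarith
  -- This is where `δ₀ < 1` enters: it keeps `L` away from zero uniformly in `δ`.
  have hL₀ : 0 < Real.log (1 / δ₀) := Real.log_pos (by rw [lt_div_iff₀ hδ₀]; linarith)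
  have hb : 0 < (r : ℝ) * c₂ := by positivity
  obtain ⟨A, hA, hlogA⟩ := LegendreDiff.exists_one_add_log_le (a := P - S) hL₀ hκ hb
  set L₀ : ℝ := Real.log (1 / δ₀)
  refine ⟨C₁ * (c₁ ^ (-ρ) * A ^ (1 - S) * L₀ ^ (-(1 / 2) : ℝ)) +
    C₂ * (((r : ℝ) * c₂) ^ (2 * (r : ℝ) - 1 / 2 + 1 - P) * A ^ (1 - P) * L₀ ^ (-(1 / 2) : ℝ)),
    by positivity, ?_⟩
  intro f δ y n hf hδ hδle hy hn₁ hn₂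
  have hL : L₀ ≤ Real.log (1 / δ) :=
    Real.log_le_log (by positivity) (one_div_le_one_div_of_le hδ hδle)
  have hexp : Real.exp (Real.log (1 / δ)) = δ⁻¹ := by
    rw [Real.exp_log (by positivity), one_div]
  set L : ℝ := Real.log (1 / δ)
  have hL' : 0 < L := hL₀.trans_le hL
  set X : ℝ := δ⁻¹ * L ^ (P - S) with hX
  have hX0 : 0 < X := by positivity
  set Y : ℝ := X ^ (1 / κ) with hYdef
  have hY : 0 < Y := by positivity
  have hn0 : (0 : ℝ) < n := lt_of_lt_of_le (by positivity) hn₁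
  have hn1 : 1 ≤ n := by exact_mod_cast hn0
  have hNcast : ((r * n : ℕ) : ℝ) = r * n := by push_cast; rfl
  have hN0 : (0 : ℝ) < ((r * n : ℕ) : ℝ) := by rw [hNcast]; positivity
  have hN : ((r * n : ℕ) : ℝ) ≤ (r : ℝ) * c₂ * Y := by
    rw [hNcast, mul_assoc]; gcongr
  have hnN : (n : ℝ) ≤ ((r * n : ℕ) : ℝ) := by
    rw [hNcast]; exact le_mul_of_one_le_left hn0.le hr'
  have hlog0 : 0 ≤ 1 + Real.log ((r * n : ℕ) : ℝ) :=
    add_nonneg zero_le_one (Real.log_natCast_nonneg _)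
  have hlog : 1 + Real.log ((r * n : ℕ) : ℝ) ≤ A * L :=
    hlogA L _ hL hN0 (by rw [hexp]; exact hN)
  have hYκ : Y ^ (-κ) = δ * L ^ (S - P) := by
    rw [hYdef, ← Real.rpow_mul hX0.le, show 1 / κ * -κ = -1 by field_simp, Real.rpow_neg_one, hX,
      mul_inv, inv_inv, ← Real.rpow_neg hL'.le, neg_sub]
  have hYρ : (δ * L ^ (S - P)) ^ (ρ / κ) = Y ^ (-ρ) := by
    rw [← hYκ, ← Real.rpow_mul hY.le]
    congr 1
    field_simp
  have hδY : δ = Y ^ (-κ) * L ^ (P - S) := by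
    rw [hYκ, mul_assoc, ← Real.rpow_add hL']; simp
  have e₁ := LegendreDiff.truncation_term_le hρ.le hS1 hA hL₀ hL hc₁ hY hn₁ hnN hlog0 hlog
  have e₂ := LegendreDiff.perturbation_term_le (ρ := ρ) (η := 2 * (r : ℝ) - 1 / 2)
    (by linarith) hP1 (by rw [hκdef, hρdef]; ring) hA hL₀ hL hb hY hδY hN0 hN hlog0 hlog
  rw [hYρ, mul_assoc, add_mul, mul_assoc C₁, mul_assoc C₂]
  calc _ ≤ ‖LegendreDiff.mixedDeriv r f - LegendreDiff.truncation r n (LegendreDiff.coeff f)‖ +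
        ‖LegendreDiff.truncation r n (LegendreDiff.coeff f) - LegendreDiff.truncation r n y‖ :=
        norm_sub_le_norm_sub_add_norm_sub _ _ _
    _ ≤ _ := add_le_add ((h₁ f hf n hn1).trans (mul_le_mul_of_nonneg_left e₁ hC₁.le))
        ((h₂ f δ y n hy).trans (mul_le_mul_of_nonneg_left e₂ hC₂.le))
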